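/- Let $\mathcal F=\{tK_2 : t\ge 1\}$ be the family of matchings (where $tK_2$ consists of $t$ pairwise disjoint edges). For a graph $G$ and an integer $n\ge |V(G)|$, let $\mathrm{Lr}(n,G)=f(n,G\mid\mathcal F)$ be the smallest positive integer $k$ such that every coloring of the edges of $K_n$ using at least $k$ colors contains a copy of $G$ in which, for each color occurring on the copy, the edges of that color induce a member of $\mathcal F$; in other words, a properly edge-colored copy of $G$. Let $\mathrm{ex}(n,H)$ be the maximum number of edges in a graph on $n$ vertices that contains no subgraph isomorphic to $H$. Then, with all asymptotics for $n\to\infty$ and all other parameters fixed: (i) For every $p\ge 5$, $\mathrm{Lr}(n,K_p)=(1+o(1))\,\mathrm{ex}(n,K_{\lceil p/2\rceil})$. (ii) For every $q\ge 2$, $\mathrm{Lr}(n,K_{2q})-\mathrm{Lr}(n,K_{2q-1})=o(n^2)$. (iii) $\mathrm{Lr}(n,K_4)=o(n^2)$. (iv) For every $k\ge 4$, the wheel $W_k=C_k+K_1$ (a cycle of length $k$ together with one further vertex adjacent to all vertices of the cycle) satisfies $\mathrm{Lr}(n,W_k)=(1+o(1))\,\frac{n^2}{4}$. -/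

import Mathlib

open Filter Asymptotics

namespace LocalAntiRamsey

/-- A family of graphs, given as a predicate on graphs. -/
abbrev GraphFamily := ∀ V : Type, SimpleGraph V → Prop

/-- The graph `t K₂`: `t` pairwise disjoint edges. -/
def disjointEdges (t : ℕ) : SimpleGraph (Fin t × Fin 2) where
  Adj x y := x.1 = y.1 ∧ x.2 ≠ y.2
  symm := ⟨fun _ _ h => ⟨h.1.symm, h.2.symm⟩⟩
  loopless := ⟨fun _ h => h.2 rfl⟩

/-- The family `{t K₂ : t ≥ 1}` of matchings, up to isomorphism. -/
def matchings : GraphFamily := fun _ H => ∃ t : ℕ, 1 ≤ t ∧ Nonempty (H ≃g disjointEdges t)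

/-- The number of colors that an edge coloring of `K_n` uses. -/
noncomputable def numColors {n : ℕ} (C : SimpleGraph.TopEdgeLabeling (Fin n) ℕ) : ℕ :=
  (Set.range fun e => C e).ncard

/-- The edges of color `a` in the subgraph `S` of `K_n`, as a graph on all `n` vertices. -/
def colorClass {n : ℕ} (C : SimpleGraph.TopEdgeLabeling (Fin n) ℕ) (S : SimpleGraph (Fin n))
    (a : ℕ) : SimpleGraph (Fin n) :=
  S ⊓ C.labelGraph a

/-- In the subgraph `S` of `K_n`, for every color `a` that occurs on `S`, the edges of color `a`
induce a member of `F`. The graph induced by a set of edges has these edges, and its vertices are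
their endpoints. -/
def IsColoredBy (F : GraphFamily) {n : ℕ} (C : SimpleGraph.TopEdgeLabeling (Fin n) ℕ)
    (S : SimpleGraph (Fin n)) : Prop :=
  ∀ a : ℕ, colorClass C S a ≠ ⊥ →
    F (colorClass C S a).support ((colorClass C S a).induce (colorClass C S a).support)

/-- `f(n, G | F)`: the smallest positive integer `k` such that every coloring of the edges of `K_n`
using at least `k` colors has a copy of `G` (the image of `G` under an injection of its vertices)
in which the edges of each occurring color induce a member of `F`. -/
noncomputable def f (n : ℕ) {V : Type*} (G : SimpleGraph V) (F : GraphFamily) : ℕ :=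
  sInf {k : ℕ | 1 ≤ k ∧ ∀ C : SimpleGraph.TopEdgeLabeling (Fin n) ℕ, k ≤ numColors C →
    ∃ φ : V ↪ Fin n, IsColoredBy F C (G.map φ)}

/-- `Lr(n, G)`, the function `f(n, G | F)` for the family `F` of matchings. -/
noncomputable def Lr (n : ℕ) {V : Type*} (G : SimpleGraph V) : ℕ := f n G matchings

/-- The complete graph `K_p`. -/
abbrev K (p : ℕ) : SimpleGraph (Fin p) := ⊤

/-- The wheel `W_k = C_k + K_1`: the join of the cycle `C_k` and a single vertex. -/
def wheel (k : ℕ) : SimpleGraph (Fin k ⊕ Fin 1) :=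
  (SimpleGraph.cycleGraph k ⊕g K 1) ⊔ completeBipartiteGraph (Fin k) (Fin 1)

end LocalAntiRamsey

/-! Every case reduces to one number: the largest `r` such that no partition of the vertices of `H`
into `r` classes makes each class induce a matching. Then `Lr n H` is `(1 - 1 / r) n² / 2 + o(n²)`.
Lower bound: give the edges of the `r`-part Turán graph distinct colors and all other edges one
further color. A properly colored copy of `H` would split into `r` classes inducing matchings. Upper
bound: one edge of each color forms a rainbow graph. With more edges than the extremal number it
contains a large complete `(r + 1)`-partite graph, which Erdős–Stone bounds. Inside the parts
nothing is known about the colors, but the color of an inner pair clashes with at most one rainbow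
edge. A counting argument then chooses pairs free of clashes (`exists_proper_blocks`), and `H`
embeds with its inner edges on these pairs. For `K_p`, `r = ⌈p/2⌉ - 1`, by pairing up vertices; for
wheels, `r = 2`. -/

namespace LocalAntiRamsey

/-! ### Choosing pairs without color clashes -/

/-- If each element of `I × Fin M` conflicts with at most one other and `M` exceeds the size of `I`,
then there is a conflict-free transversal. -/
theorem exists_conflictFree_transversal {I : Type*} [Fintype I] {M : ℕ}
    (hM : Fintype.card I < M) (R : I × Fin M → I × Fin M → Prop)
    (hR : ∀ x y y', R x y → R x y' → y = y') :
    ∃ g : I → Fin M, ∀ i j, i ≠ j → ¬ R (i, g i) (j, g j) := by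
  classical
  by_contra! hbad
  let bad (i : I) : Finset (I → Fin M) :=
    Finset.univ.filter fun g => ∃ j, i ≠ j ∧ R (i, g i) (j, g j)
  have hcover : (Finset.univ : Finset (I → Fin M)) ⊆ Finset.univ.biUnion bad := by
    intro g _
    obtain ⟨i, j, hij, h⟩ := hbad g
    simp only [bad, Finset.mem_biUnion, Finset.mem_filter, Finset.mem_univ, true_and]
    exact ⟨i, j, hij, h⟩
  have hcard (i : I) : M * (bad i).card ≤ Fintype.card (I → Fin M) := by
    have hj : ∀ g : I → Fin M, ∃ j, g ∈ bad i → i ≠ j ∧ R (i, g i) (j, g j) := fun g => by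
      by_cases hg : g ∈ bad i
      · obtain ⟨j, hj⟩ := (Finset.mem_filter.1 hg).2
        exact ⟨j, fun _ => hj⟩
      · exact ⟨i, fun h => absurd h hg⟩
    choose J hJ using hj
    have hne := fun g hg => (hJ g hg).1
    have hRJ := fun g hg => (hJ g hg).2
    -- Overwriting `g` at the clashing index is injective on pairs (new value, bad `g`): `g i`
    -- survives and determines the unique partner, hence both the overwritten index and its old
    -- value. So a bad set has density at most `1 / M`.
    have := Finset.card_le_card_of_injOn (s := (Finset.univ : Finset (Fin M)) ×ˢ bad i)
      (t := (Finset.univ : Finset (I → Fin M))) (fun p => Function.update p.2 (J p.2) p.1)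
      (fun _ _ => Finset.mem_coe.2 (Finset.mem_univ _)) ?_
    · simpa using this
    · rintro ⟨a, g⟩ hg ⟨b, h⟩ hh heq
      have hg : g ∈ bad i := by simpa using hg
      have hh : h ∈ bad i := by simpa using hh
      have hi : g i = h i := by
        have := congrFun heq i
        simpa [Function.update_of_ne (hne g hg), Function.update_of_ne (hne h hh)] using this
      have hy := hR _ _ _ (hRJ g hg) (hi ▸ hRJ h hh)
      obtain ⟨hJ, hgJ⟩ := Prod.mk.inj hy
      simp only [hJ] at heq hgJ
      have hab : a = b := by simpa using congrFun heq (J h)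
      refine Prod.ext hab (funext fun x => ?_)
      by_cases hx : x = J h
      · simpa [hx] using hgJ
      · simpa [Function.update_of_ne hx] using congrFun heq x
  have htotal := (Finset.card_le_card hcover).trans Finset.card_biUnion_le
  rw [Finset.card_univ] at htotal
  have hpos : 0 < Fintype.card (I → Fin M) := by
    have : Nonempty (Fin M) := ⟨⟨0, by omega⟩⟩
    exact Fintype.card_pos
  have h1 : M * Fintype.card (I → Fin M) ≤ Fintype.card I * Fintype.card (I → Fin M) := by
    calc M * Fintype.card (I → Fin M) ≤ M * ∑ i, (bad i).card := Nat.mul_le_mul_left _ htotal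
      _ = ∑ i, M * (bad i).card := Finset.mul_sum _ _ _
      _ ≤ ∑ _i : I, Fintype.card (I → Fin M) := Finset.sum_le_sum fun i _ => hcard i
      _ = _ := by simp
  exact absurd (Nat.le_of_mul_le_mul_right h1 hpos) (by omega)

/-- In a blow-up whose edges between different parts are rainbow, one can choose one pair in every
block of every part so that the complete multipartite graph on the chosen vertices, together with
the chosen pairs as edges, is properly colored. -/
theorem exists_proper_blocks {I Q : Type*} [Fintype I] {M : ℕ} (hM : Fintype.card I < M)
    (p : I → Q) (col : I × Fin M × Fin 2 → I × Fin M × Fin 2 → ℕ)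
    (hsymm : ∀ x y, col x y = col y x)
    (hrainbow : ∀ x y x' y', p x.1 ≠ p y.1 → p x'.1 ≠ p y'.1 → col x y = col x' y' →
      (x = x' ∧ y = y') ∨ (x = y' ∧ y = x')) :
    ∃ g : I → Fin M, ∀ u v w : I × Fin 2, u ≠ v → u ≠ w → v ≠ w →
      (p u.1 = p v.1 → u.1 = v.1) → (p u.1 = p w.1 → u.1 = w.1) →
      col (u.1, g u.1, u.2) (v.1, g v.1, v.2) ≠ col (u.1, g u.1, u.2) (w.1, g w.1, w.2) := by
  -- A pair conflicts with a block in another part if a cross edge to that block has the pair's own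
  -- color. Rainbowness leaves at most one such cross edge.
  obtain ⟨g, hg⟩ := exists_conflictFree_transversal hM
    (fun x y => ∃ s s', p x.1 ≠ p y.1 ∧
      col (x.1, x.2, 0) (x.1, x.2, 1) = col (x.1, x.2, s) (y.1, y.2, s')) (by
    rintro ⟨i, a⟩ ⟨j, b⟩ ⟨k, c⟩ ⟨s, s', h1, h2⟩ ⟨r, r', h3, h4⟩
    rcases hrainbow _ _ _ _ h1 h3 (h2.symm.trans h4) with h | h
    · have := h.2
      simp only [Prod.mk.injEq] at this ⊢
      exact ⟨this.1, this.2.1⟩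
    · exact absurd (congrArg (fun x => p x.1) h.1) h3)
  have inner : ∀ (i : I) (s s' : Fin 2), s ≠ s' →
      col (i, g i, s) (i, g i, s') = col (i, g i, 0) (i, g i, 1) := by
    intro i s s' h
    fin_cases s <;> fin_cases s' <;> first | exact absurd rfl h | rfl | exact hsymm _ _
  have mixed : ∀ u v w : I × Fin 2, u ≠ v → u.1 = v.1 → p u.1 ≠ p w.1 →
      col (u.1, g u.1, u.2) (v.1, g v.1, v.2) ≠ col (u.1, g u.1, u.2) (w.1, g w.1, w.2) := by
    rintro ⟨i, s⟩ ⟨j, s'⟩ ⟨k, s''⟩ huv hij hik heq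
    obtain rfl : i = j := hij
    have hs : s ≠ s' := fun h => huv (by rw [h])
    rw [inner i s s' hs] at heq
    exact hg i k (fun h => hik (congrArg p h)) ⟨s, s'', hik, heq⟩
  refine ⟨g, fun u v w huv huw hvw hv hw => ?_⟩
  by_cases h1 : p u.1 = p v.1 <;> by_cases h2 : p u.1 = p w.1
  · obtain ⟨i, s⟩ := u; obtain ⟨j, s'⟩ := v; obtain ⟨k, s''⟩ := w
    obtain rfl : i = j := hv h1
    obtain rfl : i = k := hw h2
    exfalso
    have a1 : s ≠ s' := fun h => huv (by rw [h])
    have a2 : s ≠ s'' := fun h => huw (by rw [h])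
    have a3 : s' ≠ s'' := fun h => hvw (by rw [h])
    omega
  · exact mixed u v w huv (hv h1) h2
  · exact (mixed u w v huw (hw h2) h1).symm
  · intro heq
    rcases hrainbow _ _ _ _ h1 h2 heq with h | h
    · have := h.2
      simp only [Prod.mk.injEq] at this
      exact hvw (Prod.ext this.1 this.2.2)
    · exact absurd (congrArg (fun x => p x.1) h.1) h2

/-! ### Matchings and proper colorings -/

/-- A finite graph in which every vertex has exactly one neighbor is a matching. -/
theorem exists_iso_disjointEdges {V : Type*} [Finite V] [LinearOrder V] (G : SimpleGraph V)
    (hG : ∀ v, ∃! w, G.Adj v w) : ∃ t, Nonempty (G ≃g disjointEdges t) := by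
  have := Fintype.ofFinite V
  choose σ hσ huniq using hG
  have hσσ : ∀ v, σ (σ v) = v := fun v => (huniq (σ v) v (hσ v).symm).symm
  have hne : ∀ v, v ≠ σ v := fun v => (hσ v).ne
  -- The order selects the smaller endpoint as the label of each edge.
  let I := {v // v < σ v}
  let t := Fintype.card I
  let e : Fin t ≃ I := (Fintype.equivFin I).symm
  let F : Fin t × Fin 2 → V := fun x => if x.2 = 0 then (e x.1).1 else σ (e x.1).1
  have hF : Function.Bijective F := by
    constructor
    · rintro ⟨a, i⟩ ⟨b, j⟩ h
      have ha := (e a).2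
      have hb := (e b).2
      have hval : (e a).1 = (e b).1 → a = b := fun h => e.injective (Subtype.ext h)
      fin_cases i <;> fin_cases j <;> simp [F] at h
      · simp [hval h]
      · rw [h, hσσ] at ha
        exact absurd ha hb.not_gt
      · rw [← h, hσσ] at hb
        exact absurd ha hb.not_gt
      · have := congrArg σ h
        rw [hσσ, hσσ] at this
        simp [hval this]
    · intro v
      rcases lt_or_gt_of_ne (hne v) with h | h
      · exact ⟨(e.symm ⟨v, h⟩, 0), by simp [F]⟩
      · exact ⟨(e.symm ⟨σ v, by rwa [hσσ]⟩, 1), by simp [F, hσσ]⟩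
  have hadj : ∀ v w, G.Adj v w ↔ w = σ v := fun v w =>
    ⟨huniq v w, fun h => h ▸ hσ v⟩
  refine ⟨t, ⟨SimpleGraph.Iso.symm ⟨Equiv.ofBijective F hF, ?_⟩⟩⟩
  rintro ⟨a, i⟩ ⟨b, j⟩
  have key : ∀ (a : Fin t) (i : Fin 2), σ (F (a, i)) = F (a, i + 1) := by
    intro a i
    fin_cases i <;> simp [F, hσσ]
  change G.Adj (F (a, i)) (F (b, j)) ↔ a = b ∧ i ≠ j
  rw [hadj, key, hF.1.eq_iff, Prod.mk.injEq]
  constructor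
  · rintro ⟨rfl, rfl⟩
    exact ⟨rfl, by omega⟩
  · rintro ⟨rfl, h⟩
    exact ⟨rfl, by omega⟩

section

variable {n : ℕ} {C : SimpleGraph.TopEdgeLabeling (Fin n) ℕ} {S : SimpleGraph (Fin n)}

theorem colorClass_adj {a : ℕ} {x y : Fin n} :
    (colorClass C S a).Adj x y ↔ S.Adj x y ∧ ∃ h : x ≠ y, C.get x y h = a := by
  simp [colorClass]

/-- A subgraph colored by matchings is exactly a properly colored one. -/
theorem isColoredBy_matchings_iff :
    IsColoredBy matchings C S ↔ ∀ x y z (hy : S.Adj x y) (hz : S.Adj x z),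
      C.get x y hy.ne = C.get x z hz.ne → y = z := by
  constructor
  · intro h x y z hy hz heq
    set a := C.get x y hy.ne with ha
    have h1 : (colorClass C S a).Adj x y := colorClass_adj.2 ⟨hy, hy.ne, rfl⟩
    have h2 : (colorClass C S a).Adj x z := colorClass_adj.2 ⟨hz, hz.ne, heq.symm⟩
    obtain ⟨t, -, ⟨e⟩⟩ := h a (fun hb => by simp [hb] at h1)
    let x' : (colorClass C S a).support :=
      ⟨x, (SimpleGraph.mem_support _).2 ⟨y, h1⟩⟩
    let y' : (colorClass C S a).support :=
      ⟨y, (SimpleGraph.mem_support _).2 ⟨x, h1.symm⟩⟩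
    let z' : (colorClass C S a).support :=
      ⟨z, (SimpleGraph.mem_support _).2 ⟨x, h2.symm⟩⟩
    have e1 : (disjointEdges t).Adj (e x') (e y') := e.map_adj_iff.2 h1
    have e2 : (disjointEdges t).Adj (e x') (e z') := e.map_adj_iff.2 h2
    have : e y' = e z' := by
      have b1 := e1.2
      have b2 := e2.2
      exact Prod.ext (e1.1.symm.trans e2.1) (by omega)
    exact congrArg Subtype.val (e.injective this)
  · intro h a ha
    obtain ⟨t, ⟨e⟩⟩ := exists_iso_disjointEdges
      ((colorClass C S a).induce (colorClass C S a).support) (by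
        rintro ⟨x, hx⟩
        obtain ⟨y, hxy⟩ := (SimpleGraph.mem_support _).1 hx
        refine ⟨⟨y, (SimpleGraph.mem_support _).2 ⟨x, hxy.symm⟩⟩, hxy, ?_⟩
        rintro ⟨z, hz⟩ hxz
        have hxz : (colorClass C S a).Adj x z := hxz
        obtain ⟨s1, _, c1⟩ := colorClass_adj.1 hxy
        obtain ⟨s2, _, c2⟩ := colorClass_adj.1 hxz
        exact Subtype.ext (h x z y s2 s1 (c2.trans c1.symm)))
    refine ⟨t, ?_, ⟨e⟩⟩
    obtain ⟨x, y, hxy⟩ := SimpleGraph.ne_bot_iff_exists_adj.1 ha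
    exact Nat.pos_of_ne_zero fun h0 => by
      subst h0
      exact (e ⟨x, (SimpleGraph.mem_support _).2 ⟨y, hxy⟩⟩).1.elim0

end

/-! ### Upper and lower bounds for `Lr` -/

/-- Choosing one edge of every color gives a rainbow graph with as many edges as there are
colors. -/
theorem exists_rainbow_subgraph {n : ℕ} (C : SimpleGraph.TopEdgeLabeling (Fin n) ℕ) :
    ∃ G : SimpleGraph (Fin n), G.edgeSet.ncard = numColors C ∧
      ∀ x y x' y' (h : G.Adj x y) (h' : G.Adj x' y'),
        C.get x y h.ne = C.get x' y' h'.ne → s(x, y) = s(x', y') := by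
  let C' : (⊤ : SimpleGraph (Fin n)).edgeSet → ℕ := C
  let T : Set (Sym2 (Fin n)) := Set.range fun a : Set.range C' => (Set.rangeSplitting C' a).1
  have hTe : (SimpleGraph.fromEdgeSet T).edgeSet = T := by
    rw [SimpleGraph.edgeSet_fromEdgeSet, sdiff_eq_left, Set.disjoint_left]
    rintro _ ⟨a, rfl⟩ hd
    exact SimpleGraph.not_isDiag_of_mem_edgeSet _ (Set.rangeSplitting C' a).2 hd
  refine ⟨SimpleGraph.fromEdgeSet T, ?_, ?_⟩
  · rw [hTe, ← Nat.card_coe_set_eq, Nat.card_range_of_injective, Nat.card_coe_set_eq]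
    · rfl
    · exact Subtype.val_injective.comp (Set.rangeSplitting_injective C')
  · intro x y x' y' h h' heq
    obtain ⟨a, ha⟩ := ((SimpleGraph.fromEdgeSet_adj T).1 h).1
    obtain ⟨b, hb⟩ := ((SimpleGraph.fromEdgeSet_adj T).1 h').1
    have ha' : C.get x y h.ne = a := by
      rw [← Set.apply_rangeSplitting C' a]
      exact congrArg C' (Subtype.ext ha.symm)
    have hb' : C.get x' y' h'.ne = b := by
      rw [← Set.apply_rangeSplitting C' b]
      exact congrArg C' (Subtype.ext hb.symm)
    have hab : a = b := Subtype.ext (ha'.symm.trans (heq.trans hb'))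
    rw [← ha, ← hb, hab]

/-- If `H` embeds into the complete `q`-partite graph with a perfect matching added in each part,
then `Lr n H` is at most an extremal number of a complete `q`-partite graph, plus one. -/
theorem exists_Lr_le_extremalNumber_add_one {V : Type*} (H : SimpleGraph V) {q m : ℕ} (hm : 0 < m)
    (e : V → Fin q × Fin m × Fin 2) (he : Function.Injective e)
    (hadj : ∀ u v, H.Adj u v → (e u).1 = (e v).1 → (e u).2.1 = (e v).2.1) :
    ∃ t, 0 < t ∧ ∀ n, Lr n H ≤
      SimpleGraph.extremalNumber n (SimpleGraph.completeEquipartiteGraph q t) + 1 := by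
  classical
  -- One more than the number of blocks `Fin q × Fin m`, as the transversal requires; a part of size
  -- `t` holds `M` candidate pairs for each of its `m` blocks.
  let M := q * m + 1
  let t := m * (M * 2)
  let E : Fin m × Fin M × Fin 2 ≃ Fin t := Fintype.equivFinOfCardEq (by simp [t])
  refine ⟨t, by positivity, fun n => Nat.sInf_le ⟨Nat.succ_pos _, fun C hC => ?_⟩⟩
  obtain ⟨G, hGcard, hG⟩ := exists_rainbow_subgraph C
  obtain ⟨f⟩ : (SimpleGraph.completeEquipartiteGraph q t).IsContained G := by
    apply SimpleGraph.IsContained.of_extremalNumber_lt_card_edgeFinset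
    rw [Fintype.card_fin, ← SimpleGraph.coe_edgeFinset, Set.ncard_coe_finset] at *
    omega
  let ψ : (Fin q × Fin m) × Fin M × Fin 2 → Fin n := fun x => f (x.1.1, E (x.1.2, x.2))
  have hψ : Function.Injective ψ := by
    rintro ⟨⟨a, b⟩, c⟩ ⟨⟨a', b'⟩, c'⟩ h
    have := f.injective h
    simp only [Prod.mk.injEq, E.injective.eq_iff] at this
    obtain ⟨rfl, rfl, rfl⟩ := this
    rfl
  have hψG : ∀ x y, x.1.1 ≠ y.1.1 → G.Adj (ψ x) (ψ y) := fun x y h =>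
    f.toHom.map_adj (SimpleGraph.completeEquipartiteGraph_adj.2 h)
  let col : Fin n → Fin n → ℕ := fun x y => if h : x ≠ y then C.get x y h else 0
  have hcol : ∀ x y (h : x ≠ y), col x y = C.get x y h := fun x y h => dif_pos h
  have hcol_symm : ∀ x y, col x y = col y x := by
    intro x y
    by_cases h : x = y
    · rw [h]
    · rw [hcol x y h, hcol y x (Ne.symm h), SimpleGraph.EdgeLabeling.get_comm]
  obtain ⟨g, hg⟩ := exists_proper_blocks (I := Fin q × Fin m) (M := M) (by simp [M]) Prod.fst
    (fun x y => col (ψ x) (ψ y)) (fun x y => hcol_symm _ _) (by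
      intro x y x' y' h h' heq
      have a := hψG x y h
      have a' := hψG x' y' h'
      rw [hcol _ _ a.ne, hcol _ _ a'.ne] at heq
      have := hG _ _ _ _ a a' heq
      rwa [Sym2.eq_iff, hψ.eq_iff, hψ.eq_iff, hψ.eq_iff, hψ.eq_iff] at this)
  let ι : V → (Fin q × Fin m) × Fin 2 := fun v => (((e v).1, (e v).2.1), (e v).2.2)
  have hι : Function.Injective ι := by
    intro u v h
    simp only [ι, Prod.mk.injEq] at h
    exact he (Prod.ext h.1.1 (Prod.ext h.1.2 h.2))
  let φ : V → Fin n := fun v => ψ ((ι v).1, g (ι v).1, (ι v).2)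
  have hφ : Function.Injective φ := by
    intro u v h
    have := hψ h
    simp only [Prod.mk.injEq] at this
    exact hι (Prod.ext this.1 this.2.2)
  have hblock : ∀ u v, H.Adj u v → (ι u).1.1 = (ι v).1.1 → (ι u).1 = (ι v).1 := fun u v h h1 =>
    Prod.ext h1 (hadj u v h h1)
  refine ⟨⟨φ, hφ⟩, isColoredBy_matchings_iff.2 ?_⟩
  rintro x y z hy hz heq
  obtain ⟨u, v, huv, rfl, rfl⟩ := (SimpleGraph.map_adj _ _ _ _).1 hy
  obtain ⟨u', w, huw, hu', rfl⟩ := (SimpleGraph.map_adj _ _ _ _).1 hz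
  obtain rfl := hφ hu'
  by_contra hvw
  refine hg (ι u') (ι v) (ι w) (hι.ne huv.ne) (hι.ne huw.ne)
    (fun h => hvw (congrArg φ (hι h))) (hblock _ _ huv) (hblock _ _ huw) ?_
  rw [← hcol, ← hcol] at heq
  exact heq

/-- If every `r`-coloring of the vertices of `H` has a monochromatic path with two edges, then
`Lr n H` is at least the number of edges of the Turán graph with `r` parts. -/
theorem card_edgeFinset_turanGraph_le_Lr {V : Type*} (H : SimpleGraph V) {r : ℕ} (hr : 0 < r)
    (hH : ∀ c : V → Fin r, ∃ u v w, v ≠ w ∧ H.Adj u v ∧ H.Adj u w ∧ c u = c v ∧ c u = c w)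
    (n : ℕ) : (SimpleGraph.turanGraph n r).edgeFinset.card ≤ Lr n H := by
  classical
  apply le_csInf
  -- The infimum is over a nonempty set: no coloring has more colors than edges.
  · refine ⟨Nat.card (⊤ : SimpleGraph (Fin n)).edgeSet + 1, Nat.succ_pos _, fun C hC => ?_⟩
    have : numColors C ≤ Nat.card (⊤ : SimpleGraph (Fin n)).edgeSet := by
      rw [numColors, ← Nat.card_coe_set_eq]
      exact Finite.card_range_le _
    omega
  rintro k ⟨-, hk⟩
  by_contra! hlt
  let T := SimpleGraph.turanGraph n r
  let N := Fintype.equivFin (Sym2 (Fin n))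
  let C : SimpleGraph.TopEdgeLabeling (Fin n) ℕ := fun e =>
    if e.1 ∈ T.edgeSet then (N e.1).val + 1 else 0
  have hC : T.edgeFinset.card ≤ numColors C := by
    have hinj : Function.Injective fun e : Sym2 (Fin n) => (N e).val + 1 := fun a b h =>
      N.injective (Fin.ext (Nat.succ_injective h))
    rw [numColors, ← Finset.card_image_of_injective _ hinj, ← Set.ncard_coe_finset]
    refine Set.ncard_le_ncard ?_ (Set.finite_range _)
    intro a ha
    obtain ⟨e, he, rfl⟩ := Finset.mem_image.1 (Finset.mem_coe.1 ha)
    have he := SimpleGraph.mem_edgeFinset.1 he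
    refine ⟨⟨e, SimpleGraph.edgeSet_mono le_top he⟩, ?_⟩
    simp [C, he]
  obtain ⟨φ, hφ⟩ := hk C (hlt.le.trans hC)
  rw [isColoredBy_matchings_iff] at hφ
  obtain ⟨u, v, w, hvw, huv, huw, hcv, hcw⟩ := hH fun v => ⟨(φ v).val % r, Nat.mod_lt _ hr⟩
  have zero : ∀ x (h : H.Adj u x), (φ u).val % r = (φ x).val % r →
      C.get (φ u) (φ x) (φ.injective.ne h.ne) = 0 := by
    intro x h hx
    rw [SimpleGraph.EdgeLabeling.get_eq]
    simp [C, T, SimpleGraph.turanGraph_adj, hx]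
  refine hvw (φ.injective (hφ (φ u) (φ v) (φ w) ?_ ?_ ?_))
  · exact (SimpleGraph.map_adj _ _ _ _).2 ⟨u, v, huv, rfl, rfl⟩
  · exact (SimpleGraph.map_adj _ _ _ _).2 ⟨u, w, huw, rfl, rfl⟩
  · rw [zero v huv (Fin.mk.inj hcv), zero w huw (Fin.mk.inj hcw)]

/-! ### Erdős–Stone and Turán asymptotics -/

open SimpleGraph in
/-- The upper bound of the **Erdős–Stone theorem**. -/
theorem eventually_extremalNumber_completeEquipartiteGraph_le {r t : ℕ} (hr : 0 < r) (ht : 0 < t)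
    {ε : ℝ} (hε : 0 < ε) :
    ∀ᶠ n : ℕ in atTop, (extremalNumber n (completeEquipartiteGraph (r + 1) t) : ℝ) ≤
      ((1 - 1 / r) / 2 + ε) * (n : ℝ) ^ 2 := by
  classical
  set H := completeEquipartiteGraph (r + 1) t
  have hH : H ≠ ⊥ := by
    rw [Ne, completeEquipartiteGraph_eq_bot_iff]
    omega
  set a : ℝ := 1 - 1 / r + ε
  have ha : 0 < a := by
    have : (1 : ℝ) / r ≤ 1 := by
      rw [div_le_one (by positivity)]
      exact_mod_cast hr
    simp only [a]
    linarith
  obtain ⟨N, hN⟩ := eventually_atTop.1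
    (eventually_completeEquipartiteGraph_isContained_of_minDegree hε r t)
  -- An extremal graph has minimum degree below `a * (n + 1)` by the minimum-degree form of the
  -- theorem; deleting a vertex of minimum degree gives the recursion.
  have step : ∀ n, N ≤ n + 1 →
      (extremalNumber (n + 1) H : ℝ) ≤ extremalNumber n H + a * (n + 1) := by
    intro n hn
    obtain ⟨G, _, hG⟩ := exists_isExtremal_free (V := Fin (n + 1)) hH
    have hcard := card_edgeFinset_of_isExtremal_free hG
    have hdeg : (G.minDegree : ℝ) < a * (n + 1 : ℕ) := by
      by_contra! h
      exact hG.prop (hN (n + 1) hn h)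
    obtain ⟨v, hv⟩ := G.exists_minimal_degree_vertex
    have hdel := card_edgeFinset_deleteIncidenceSet_le_extremalNumber hG.prop v
    rw [card_edgeFinset_deleteIncidenceSet] at hdel
    rw [Fintype.card_fin] at hcard hdel
    have h1 : extremalNumber (n + 1) H ≤ extremalNumber n H + G.minDegree := by
      rw [hv, ← hcard]
      simpa using Nat.sub_le_iff_le_add.1 hdel
    have h2 : (extremalNumber (n + 1) H : ℝ) ≤ extremalNumber n H + G.minDegree := by
      exact_mod_cast h1
    push_cast at hdeg
    linarith
  have bound : ∀ k, (extremalNumber (N + k) H : ℝ) ≤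
      extremalNumber N H + a * (((N + k : ℕ) : ℝ) * ((N + k : ℕ) + 1) / 2) := by
    intro k
    induction k with
    | zero =>
      have : 0 ≤ a * ((N : ℝ) * (N + 1) / 2) := by positivity
      simpa using this
    | succ k ih =>
      have := step (N + k) (by omega)
      push_cast at this ih ⊢
      rw [← add_assoc]
      linear_combination this + ih
  -- Since `a / 2` spends only `ε / 2`, the other `ε / 2` absorbs the lower-order terms.
  have hlin : ∀ᶠ n : ℕ in atTop,
      (extremalNumber N H + a / 2 : ℝ) * n ≤ ε / 2 * (n : ℝ) ^ 2 := by
    filter_upwards [tendsto_natCast_atTop_atTop.eventually_ge_atTop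
      ((extremalNumber N H + a / 2 : ℝ) / (ε / 2))] with n hn
    rw [div_le_iff₀ (by positivity)] at hn
    nlinarith [n.cast_nonneg (α := ℝ)]
  filter_upwards [hlin, eventually_ge_atTop N, eventually_ge_atTop 1] with n h1 h2 h3
  have h4 := bound (n - N)
  rw [Nat.add_sub_cancel' h2] at h4
  have h5 : (extremalNumber N H : ℝ) ≤ extremalNumber N H * n :=
    le_mul_of_one_le_right (Nat.cast_nonneg _) (by exact_mod_cast h3)
  simp only [a] at *
  linear_combination h4 + h5 + h1

/-- The Turán graph has at least `(1 - 1 / r) n² / 2` edges, up to a constant. -/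
theorem le_card_edgeFinset_turanGraph {r : ℕ} (hr : 0 < r) (n : ℕ) :
    (1 - 1 / r) / 2 * (n : ℝ) ^ 2 - (r ^ 2 + 1) ≤
      ((SimpleGraph.turanGraph n r).edgeFinset.card : ℝ) := by
  have h : (n ^ 2 - (n % r) ^ 2) * (r - 1) / (2 * r) ≤
      (SimpleGraph.turanGraph n r).edgeFinset.card := by
    rw [SimpleGraph.card_edgeFinset_turanGraph]
    exact Nat.le_add_right _ _
  have h1 : (n ^ 2 - (n % r) ^ 2) * (r - 1) <
      ((SimpleGraph.turanGraph n r).edgeFinset.card + 1) * (2 * r) :=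
    (Nat.div_lt_iff_lt_mul (by positivity)).1 (by omega)
  have hmod : n % r < r := Nat.mod_lt _ hr
  have hmod' : n % r ≤ n := Nat.mod_le _ _
  have h2 : ((n : ℝ) ^ 2 - ((n % r : ℕ) : ℝ) ^ 2) * (r - 1) <
      ((SimpleGraph.turanGraph n r).edgeFinset.card + 1) * (2 * r) := by
    have := (Nat.cast_lt (α := ℝ)).2 h1
    rw [Nat.cast_mul, Nat.cast_sub (Nat.pow_le_pow_left hmod' 2), Nat.cast_sub hr] at this
    exact_mod_cast this
  have h3 : ((n % r : ℕ) : ℝ) ^ 2 ≤ (r : ℝ) ^ 2 := by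
    exact_mod_cast Nat.pow_le_pow_left hmod.le 2
  have hr1 : (1 : ℝ) ≤ r := by exact_mod_cast hr
  have h4 : (1 - 1 / r) / 2 * (n : ℝ) ^ 2 = (n : ℝ) ^ 2 * (r - 1) / (2 * r) := by
    field_simp
  rw [h4, sub_le_iff_le_add, div_le_iff₀ (by positivity)]
  -- In the error `r ^ 2 + 1`, `r ^ 2` pays for the remainder `n % r` and `1` for the floor.
  have h5 : ((n % r : ℕ) : ℝ) ^ 2 * (r - 1) ≤ (r : ℝ) ^ 2 * (2 * r) := by
    apply mul_le_mul h3 <;> first | positivity | linarith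
  linarith

/-- A function between the number of edges of the Turán graph with `r` parts and the extremal number
of a complete `(r + 1)`-partite graph is `(1 - 1 / r) n² / 2 + o(n²)`. -/
theorem isLittleO_of_le_of_le {r t : ℕ} (hr : 0 < r) (ht : 0 < t) (L : ℕ → ℕ)
    (hlow : ∀ n, (SimpleGraph.turanGraph n r).edgeFinset.card ≤ L n)
    (hup : ∀ n, L n ≤
      SimpleGraph.extremalNumber n (SimpleGraph.completeEquipartiteGraph (r + 1) t) + 1) :
    (fun n => (L n : ℝ) - (1 - 1 / r) / 2 * (n : ℝ) ^ 2) =o[atTop] fun n : ℕ => (n : ℝ) ^ 2 := by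
  rw [isLittleO_iff]
  intro ε hε
  have hconst : ∀ᶠ n : ℕ in atTop, (r ^ 2 + 1 : ℝ) ≤ ε / 2 * (n : ℝ) ^ 2 := by
    have : Tendsto (fun n : ℕ => ε / 2 * (n : ℝ) ^ 2) atTop atTop :=
      ((tendsto_pow_atTop two_ne_zero).comp tendsto_natCast_atTop_atTop).const_mul_atTop
        (by positivity)
    exact this.eventually_ge_atTop _
  filter_upwards [hconst,
    eventually_extremalNumber_completeEquipartiteGraph_le hr ht (half_pos hε)] with n h1 h2
  have h3 : ((SimpleGraph.turanGraph n r).edgeFinset.card : ℝ) ≤ L n := by exact_mod_cast hlow n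
  have h4 : (L n : ℝ) ≤
      SimpleGraph.extremalNumber n (SimpleGraph.completeEquipartiteGraph (r + 1) t) + 1 := by
    exact_mod_cast hup n
  have h5 := le_card_edgeFinset_turanGraph hr n
  have h6 : (0 : ℝ) ≤ (r : ℝ) ^ 2 := by positivity
  have h7 : 0 ≤ ε / 2 * (n : ℝ) ^ 2 := by positivity
  rw [Real.norm_eq_abs, Real.norm_of_nonneg (by positivity), abs_le]
  constructor <;> linarith

/-- Turán's theorem makes the lower bound an equality, and parts of size one give the upper bound.
-/
theorem isLittleO_extremalNumber_K_sub {r : ℕ} (hr : 0 < r) :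
    (fun n => (SimpleGraph.extremalNumber n (K (r + 1)) : ℝ) - (1 - 1 / r) / 2 * (n : ℝ) ^ 2)
      =o[atTop] fun n : ℕ => (n : ℝ) ^ 2 := by
  refine isLittleO_of_le_of_le hr one_pos _ (fun n => ?_) (fun n => ?_)
  · have : Nontrivial (Fin (r + 1)) := Fin.nontrivial_iff_two_le.2 (by omega)
    rw [K, SimpleGraph.extremalNumber_top, Fintype.card_fin]
    rfl
  · refine (SimpleGraph.IsContained.extremalNumber_le ?_).trans (Nat.le_succ _)
    exact ⟨⟨⟨fun i => (i, 0), fun h => h⟩, fun i j h => (Prod.mk.inj h).1⟩⟩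

/-- The asymptotics of `Lr n H` for a graph `H` that embeds into the complete `(r + 1)`-partite
graph with perfect matchings added to its parts, but has no partition into `r` parts inducing
matchings. -/
theorem isLittleO_Lr_sub {V : Type*} (H : SimpleGraph V) {r m : ℕ} (hr : 0 < r) (hm : 0 < m)
    (e : V → Fin (r + 1) × Fin m × Fin 2) (he : Function.Injective e)
    (hadj : ∀ u v, H.Adj u v → (e u).1 = (e v).1 → (e u).2.1 = (e v).2.1)
    (hH : ∀ c : V → Fin r, ∃ u v w, v ≠ w ∧ H.Adj u v ∧ H.Adj u w ∧ c u = c v ∧ c u = c w) :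
    (fun n => (Lr n H : ℝ) - (1 - 1 / r) / 2 * (n : ℝ) ^ 2) =o[atTop] fun n : ℕ => (n : ℝ) ^ 2 := by
  obtain ⟨t, ht, hup⟩ := exists_Lr_le_extremalNumber_add_one H hm e he hadj
  exact isLittleO_of_le_of_le hr ht _ (card_edgeFinset_turanGraph_le_Lr H hr hH) hup

/-! ### Complete graphs and wheels -/

/-- Vertices `2 * i` and `2 * i + 1` share a part as its single pair, so `r + 1` parts suffice; with
`r` classes, some class contains a triangle. -/
theorem isLittleO_Lr_K_sub {p r : ℕ} (hr : 0 < r) (h1 : 2 * r < p) (h2 : p ≤ 2 * (r + 1)) :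
    (fun n => (Lr n (K p) : ℝ) - (1 - 1 / r) / 2 * (n : ℝ) ^ 2)
      =o[atTop] fun n : ℕ => (n : ℝ) ^ 2 := by
  refine isLittleO_Lr_sub (K p) hr one_pos
    (fun i => (⟨i.val / 2, by omega⟩, 0, ⟨i.val % 2, by omega⟩)) ?_ (fun _ _ _ _ => rfl) ?_
  · intro i j h
    simp only [Prod.mk.injEq, Fin.mk.injEq] at h
    exact Fin.ext (by omega)
  · intro c
    obtain ⟨a, ha⟩ := Fintype.exists_lt_card_fiber_of_mul_lt_card c (n := 2) (by simpa [mul_comm] using h1)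
    obtain ⟨u, hu, v, hv, w, hw, huv, huw, hvw⟩ := Finset.two_lt_card.1 ha
    simp only [Finset.mem_filter] at hu hv hw
    exact ⟨u, v, w, hvw, huv, huw, hu.2.trans hv.2.symm, hu.2.trans hw.2.symm⟩

theorem cycleGraph_adj_val {k : ℕ} {i j : Fin k} (h : (SimpleGraph.cycleGraph k).Adj i j) :
    i.val = j.val + 1 ∨ j.val = i.val + 1 ∨ (i.val = 0 ∧ j.val + 1 = k) ∨
      (j.val = 0 ∧ i.val + 1 = k) := by
  have key : ∀ i j : Fin k, (i - j).val = 1 → i.val = j.val + 1 ∨ (i.val = 0 ∧ j.val + 1 = k) := by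
    intro i j h
    have hi := i.isLt
    have hj := j.isLt
    rcases le_or_gt j i with hle | hlt
    · rw [Fin.coe_sub_iff_le.2 hle] at h
      have := Fin.le_def.1 hle
      omega
    · rw [Fin.coe_sub_iff_lt.2 hlt] at h
      omega
  rcases SimpleGraph.cycleGraph_adj'.1 h with h | h
  · rcases key _ _ h with h | h <;> tauto
  · rcases key _ _ h with h | h <;> tauto

/-- Either two rim vertices share the hub's color, giving a path centered at the hub, or all rim
vertices but at most one have the other color. As `k ≥ 4`, three consecutive ones remain. -/
theorem wheel_exists_monochromatic_path {k : ℕ} (hk : 4 ≤ k) (c : Fin k ⊕ Fin 1 → Fin 2) :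
    ∃ u v w, v ≠ w ∧ (wheel k).Adj u v ∧ (wheel k).Adj u w ∧ c u = c v ∧ c u = c w := by
  obtain ⟨k, rfl⟩ := Nat.exists_eq_add_of_le' hk
  have hub : ∀ i, (wheel (k + 4)).Adj (.inr 0) (.inl i) := fun i => by simp [wheel]
  have rim : ∀ i j : Fin (k + 4), i - j = 1 ∨ j - i = 1 →
      (wheel (k + 4)).Adj (.inl i) (.inl j) := fun i j h =>
    Or.inl (SimpleGraph.sum_adj_inl.2 (SimpleGraph.cycleGraph_adj.2 h))
  by_cases h : ∃ i j, i ≠ j ∧ c (.inl i) = c (.inr 0) ∧ c (.inl j) = c (.inr 0)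
  · obtain ⟨i, j, hij, hi, hj⟩ := h
    exact ⟨.inr 0, .inl i, .inl j, by simpa, hub i, hub j, hi.symm, hj.symm⟩
  · obtain ⟨b, hb⟩ : ∃ b, ∀ i, i ≠ b → c (.inl i) ≠ c (.inr 0) := by
      by_cases h' : ∃ b, c (.inl b) = c (.inr 0)
      · obtain ⟨b, hb⟩ := h'
        exact ⟨b, fun i hi hc => h ⟨i, b, hi, hc, hb⟩⟩
      · exact ⟨0, fun i _ hc => h' ⟨i, hc⟩⟩
    have v2 : ((1 + 1 : Fin (k + 4)) : ℕ) = 2 := by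
      rw [Fin.val_add, Fin.val_one, Nat.mod_eq_of_lt (by omega)]
    have v3 : ((1 + 1 + 1 : Fin (k + 4)) : ℕ) = 3 := by
      rw [Fin.val_add, v2, Fin.val_one, Nat.mod_eq_of_lt (by omega)]
    have h2 : (1 + 1 : Fin (k + 4)) ≠ 0 := fun h => by simp [h] at v2
    have h3 : (1 + 1 + 1 : Fin (k + 4)) ≠ 0 := fun h => by simp [h] at v3
    have c1 := hb (b + 1) (by simp)
    have c2 := hb (b + (1 + 1)) (by rwa [Ne, add_eq_left])
    have c3 := hb (b + (1 + 1 + 1)) (by rwa [Ne, add_eq_left])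
    refine ⟨.inl (b + (1 + 1)), .inl (b + 1), .inl (b + (1 + 1 + 1)), ?_, rim _ _ (.inl ?_),
      rim _ _ (.inr ?_), by omega, by omega⟩
    · rwa [Ne, Sum.inl.injEq, add_right_inj, add_assoc, left_eq_add]
    · abel
    · abel

theorem isLittleO_Lr_wheel_sub {k : ℕ} (hk : 4 ≤ k) :
    (fun n => (Lr n (wheel k) : ℝ) - (1 - 1 / (2 : ℕ)) / 2 * (n : ℝ) ^ 2)
      =o[atTop] fun n : ℕ => (n : ℝ) ^ 2 := by
  let z : Fin k := ⟨0, by omega⟩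
  -- The hub is alone in its part and the rim alternates between the other two. For odd `k` the last
  -- rim vertex falls in the same part as its neighbor `0`, so it is paired with it.
  let e : Fin k ⊕ Fin 1 → Fin 3 × Fin k × Fin 2 := Sum.elim
    (fun i => if i.val % 2 = 1 then (1, i, 0) else if i.val + 1 = k then (2, z, 1) else (2, i, 0))
    (fun _ => (0, z, 0))
  refine isLittleO_Lr_sub (wheel k) two_pos (by omega : 0 < k) e ?_ ?_
    (wheel_exists_monochromatic_path hk)
  · rintro (i | i) (j | j) h
    · simp only [e, Sum.elim_inl] at h
      congr 1
      split_ifs at h <;> simp at h <;> first | exact h | exact Fin.ext (by omega)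
    · simp only [e, Sum.elim_inl, Sum.elim_inr] at h
      split_ifs at h <;> simp at h
    · simp only [e, Sum.elim_inl, Sum.elim_inr] at h
      split_ifs at h <;> simp at h
    · rw [Subsingleton.elim i j]
  · rintro (i | i) (j | j) hadj h
    · have hij : (SimpleGraph.cycleGraph k).Adj i j := by simpa [wheel] using hadj
      have := cycleGraph_adj_val hij
      simp only [e, Sum.elim_inl] at h ⊢
      split_ifs at h ⊢ <;> simp at h <;> simp [z, Fin.ext_iff] <;> omega
    · simp only [e, Sum.elim_inl, Sum.elim_inr] at h
      split_ifs at h <;> simp at h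
    · simp only [e, Sum.elim_inl, Sum.elim_inr] at h
      split_ifs at h <;> simp at h
    · rfl

theorem isEquivalent_const_mul_sq {u : ℕ → ℝ} {a : ℝ} (ha : a ≠ 0)
    (h : (fun n : ℕ => u n - a * (n : ℝ) ^ 2) =o[atTop] fun n : ℕ => (n : ℝ) ^ 2) :
    u ~[atTop] fun n : ℕ => a * (n : ℝ) ^ 2 :=
  h.const_mul_right ha

end LocalAntiRamsey

theorem mainTheorem6 :
    (∀ p : ℕ, 5 ≤ p →
      (fun n : ℕ => (LocalAntiRamsey.Lr n (LocalAntiRamsey.K p) : ℝ)) ~[atTop]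
        (fun n : ℕ =>
          (SimpleGraph.extremalNumber n (LocalAntiRamsey.K ⌈(p : ℚ) / 2⌉₊) : ℝ))) ∧
    (∀ q : ℕ, 2 ≤ q →
      (fun n : ℕ => (LocalAntiRamsey.Lr n (LocalAntiRamsey.K (2 * q)) : ℝ) -
          (LocalAntiRamsey.Lr n (LocalAntiRamsey.K (2 * q - 1)) : ℝ)) =o[atTop]
        (fun n : ℕ => (n : ℝ) ^ 2)) ∧
    ((fun n : ℕ => (LocalAntiRamsey.Lr n (LocalAntiRamsey.K 4) : ℝ)) =o[atTop]
        (fun n : ℕ => (n : ℝ) ^ 2)) ∧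
    (∀ k : ℕ, 4 ≤ k →
      (fun n : ℕ => (LocalAntiRamsey.Lr n (LocalAntiRamsey.wheel k) : ℝ)) ~[atTop]
        (fun n : ℕ => (n : ℝ) ^ 2 / 4)) := by
  open LocalAntiRamsey in
  refine ⟨fun p hp => ?_, fun q hq => ?_, ?_, fun k hk => ?_⟩
  -- `p ≥ 5` gives `r ≥ 2`, so the leading coefficient is nonzero and asymptotic equivalence makes
  -- sense.
  · obtain ⟨r, hr, h1, h2⟩ : ∃ r, 2 ≤ r ∧ 2 * r < p ∧ p ≤ 2 * (r + 1) :=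
      ⟨(p - 1) / 2, by omega, by omega, by omega⟩
    have hceil : ⌈(p : ℚ) / 2⌉₊ = r + 1 := by
      have h1' : (2 * r + 1 : ℚ) ≤ p := by exact_mod_cast h1
      have h2' : (p : ℚ) ≤ 2 * (r + 1) := by exact_mod_cast h2
      rw [Nat.ceil_eq_iff (by omega)]
      push_cast
      constructor <;> linarith
    have ha : (1 - 1 / r : ℝ) / 2 ≠ 0 := by
      have hr' : (2 : ℝ) ≤ r := by exact_mod_cast hr
      have : (1 : ℝ) / r < 1 := by rw [div_lt_one (by linarith)]; linarith
      exact ne_of_gt (by linarith)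
    rw [hceil]
    exact (isEquivalent_const_mul_sq ha (isLittleO_Lr_K_sub (by omega) h1 h2)).trans
      (isEquivalent_const_mul_sq ha (isLittleO_extremalNumber_K_sub (by omega))).symm
  -- Both cliques have the same `r`, so the leading terms cancel.
  · obtain ⟨r, rfl⟩ := Nat.exists_eq_add_of_le' (show 1 ≤ q by omega)
    have h1 := isLittleO_Lr_K_sub (p := 2 * (r + 1)) (r := r) (by omega) (by omega) le_rfl
    have h2 := isLittleO_Lr_K_sub (p := 2 * (r + 1) - 1) (r := r) (by omega) (by omega) (by omega)
    simpa using h1.sub h2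
  -- Here `r = 1`, so the leading coefficient vanishes.
  · simpa using isLittleO_Lr_K_sub (p := 4) (r := 1) one_pos (by omega) (by omega)
  · have := isEquivalent_const_mul_sq (by norm_num) (isLittleO_Lr_wheel_sub hk)
    convert this using 2 with n
    push_cast
    ring
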